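/- Let $S=\{x\in\mathbb R^3:|x|=1\}$ with surface measure $dS$, let $\mathcal E_1=L^2(S,dS)$ (complex valued functions), and use spherical coordinates $x_1=\sin\theta\cos\varphi$, $x_2=\sin\theta\sin\varphi$, $x_3=\cos\theta$ with $0\le\theta\le\pi$, $\varphi\in\mathbb R$. For $k=1,2,3$ let $R_k(\varphi)$ be the rotation of $\mathbb R^3$ by the angle $\varphi$ in the positive direction around the $k$-th coordinate axis, let $(\hat R_k(\varphi)\psi)(x)=\psi(R_k(\varphi)x)$ for $\psi\in\mathcal E_1$, and let $H_k=-i\,\frac{d}{d\varphi}\big|_{\varphi=0}\hat R_k(\varphi)$, the unbounded operator in $\mathcal E_1$ whose domain consists of all $\psi$ for which the derivative exists in the norm of $\mathcal E_1$. Let $H^2=H_1^2+H_2^2+H_3^2$ with its natural domain $\{\psi:\ \psi\in D(H_k),\ H_k\psi\in D(H_k),\ k=1,2,3\}$. Then there are smooth functions $Y_l^m:S\to\mathbb C$ (spherical harmonics), indexed by $l=0,1,2,\dots$ and $m=-l,-l+1,\dots,l$, such that: (i) The functions $Y_l^m$ form an orthonormal (Hilbert) basis of $\mathcal E_1$. They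 lie in the domains of $H_3$ and $H^2$ and are common eigenfunctions of them: $$H_3Y_l^m=m\,Y_l^m,\qquad H^2Y_l^m=l(l+1)\,Y_l^m .$$ (ii) $Y_l^m(\theta,\varphi)=F_l^m(\theta)e^{im\varphi}$ for all $\theta\in[0,\pi]$ and $\varphi\in\mathbb R$, where the functions $F_l^m:[0,\pi]\to\mathbb R$ are real valued. Moreover, for all $l$ and $m$ as above the joint eigenspace $\{\psi\in\mathcal E_1:\ H_3\psi=m\psi,\ H^2\psi=l(l+1)\psi\}$ is one-dimensional, and if $\{\psi\in\mathcal E_1:\ H_3\psi=a\psi,\ H^2\psi=b\psi\}\ne\{0\}$ for some $a,b\in\mathbb C$, then $a=m$ and $b=l(l+1)$ for such a pair $(l,m)$. -/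

import Mathlib

open MeasureTheory
open scoped Manifold ContDiff

noncomputable section

namespace SphericalHarmonics

/-- Euclidean three-space. The coordinate axes `e₁, e₂, e₃` carry the indices `0, 1, 2`. -/
abbrev E3 : Type := EuclideanSpace ℝ (Fin 3)

/-- The unit sphere `|x| = 1`. -/
abbrev S2 : Type := Metric.sphere (0 : E3) 1

/-- The surface measure on the unit sphere. -/
abbrev dS : Measure S2 := (volume : Measure E3).toSphere

/-- The complex Hilbert space of square integrable functions on the sphere. -/
abbrev L2S : Type := Lp ℂ 2 dS

/-- The rotation of the space around the axis `k` by the angle `t`, in the positive direction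
(from the axis `k + 1` towards the axis `k + 2`, indices being cyclic). -/
def axisRot (k : Fin 3) (t : ℝ) : E3 →ₗᵢ[ℝ] E3 where
  toFun x := WithLp.toLp 2 fun j =>
    if j = k then x k
    else if j = k + 1 then Real.cos t * x (k + 1) - Real.sin t * x (k + 2)
    else Real.sin t * x (k + 1) + Real.cos t * x (k + 2)
  map_add' x y := by
    ext j
    simp only [PiLp.add_apply]
    split_ifs <;> ring
  map_smul' c x := by
    ext j
    simp only [PiLp.smul_apply, smul_eq_mul, RingHom.id_apply]
    split_ifs <;> ring
  norm_map' x := by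
    rw [EuclideanSpace.norm_eq, EuclideanSpace.norm_eq]
    congr 1
    have h := Real.sin_sq_add_cos_sq t
    fin_cases k <;> simp [Fin.sum_univ_three, Real.norm_eq_abs, sq_abs]
    · linear_combination (x 1 ^ 2 + x 2 ^ 2) * h
    · linear_combination (x 2 ^ 2 + x 0 ^ 2) * h
    · linear_combination (x 0 ^ 2 + x 1 ^ 2) * h

/-- The rotation, restricted to the sphere. -/
def sphereRotation (k : Fin 3) (t : ℝ) (x : S2) : S2 :=
  ⟨axisRot k t x, by simp⟩

theorem continuous_sphereRotation (k : Fin 3) (t : ℝ) : Continuous (sphereRotation k t) :=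
  Continuous.subtype_mk ((axisRot k t).continuous.comp continuous_subtype_val) _

open scoped Pointwise in
theorem measurePreserving_sphereRotation (k : Fin 3) (t : ℝ) :
    MeasurePreserving (sphereRotation k t) dS dS := by
  have hm := (continuous_sphereRotation k t).measurable
  refine ⟨hm, Measure.ext fun s hs => ?_⟩
  rw [Measure.map_apply hm hs, Measure.toSphere_apply' _ hs, Measure.toSphere_apply' _ (hm hs)]
  congr 1
  let e : E3 ≃ₗᵢ[ℝ] E3 := (axisRot k t).toLinearIsometryEquiv rfl
  have he : ∀ x, e x = axisRot k t x := fun x => rfl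
  have hp : MeasurePreserving e.toMeasurableEquiv volume volume := e.measurePreserving
  rw [← hp.measure_preimage_equiv (Set.Ioo (0 : ℝ) 1 • (Subtype.val '' s))]
  congr 1
  ext x
  simp only [Set.mem_preimage, Set.mem_smul, Set.mem_image, Subtype.exists]
  constructor
  · rintro ⟨r, hr, _, ⟨y, hy, hys, rfl⟩, rfl⟩
    refine ⟨r, hr, _, ⟨axisRot k t y, (sphereRotation k t ⟨y, hy⟩).2, hys, rfl⟩, ?_⟩
    exact ((axisRot k t).map_smul r y).symm
  · rintro ⟨r, hr, _, ⟨y, hy, hys, rfl⟩, hxy⟩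
    have hy' : axisRot k t (e.symm y) = y := e.apply_symm_apply y
    have hn : e.symm y ∈ Metric.sphere (0 : E3) 1 := by simpa using hy
    refine ⟨r, hr, _, ⟨e.symm y, hn, ?_, rfl⟩, ?_⟩
    · have : sphereRotation k t ⟨e.symm y, hn⟩ = ⟨y, hy⟩ := Subtype.ext hy'
      rwa [this]
    · apply e.injective
      change e (r • e.symm y) = e x
      rw [map_smul, e.apply_symm_apply]
      exact hxy

/-- The rotation group on `L²(S²)`: `(R̂ₖ(t) ψ)(x) = ψ(Rₖ(t) x)`. -/
def rotHat (k : Fin 3) (t : ℝ) : L2S →ₗ[ℂ] L2S :=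
  Lp.compMeasurePreservingₗ ℂ (sphereRotation k t) (measurePreserving_sphereRotation k t)

/-- The generator `d/dt R̂ₖ(t)` at `t = 0`, an unbounded operator on `L²(S²)`; its domain
consists of all `ψ` for which the derivative exists in the norm of `L²(S²)`. -/
def rotGenerator (k : Fin 3) : L2S →ₗ.[ℂ] L2S where
  domain :=
    { carrier := {ψ | DifferentiableAt ℝ (fun t : ℝ => rotHat k t ψ) 0}
      add_mem' := fun {a b} ha hb => by
        simp only [Set.mem_ofPred_eq, map_add] at *
        exact ha.add hb
      zero_mem' := by simp
      smul_mem' := fun c a ha => by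
        simp only [Set.mem_ofPred_eq, map_smul] at *
        exact ha.const_smul c }
  toFun :=
    { toFun := fun ψ => deriv (fun t : ℝ => rotHat k t (ψ : L2S)) 0
      map_add' := fun a b => by
        simp only [Submodule.coe_add, map_add]
        exact deriv_fun_add a.2 b.2
      map_smul' := fun c a => by
        simp only [Submodule.coe_smul, map_smul, RingHom.id_apply]
        exact deriv_fun_const_smul c a.2 }

/-- The angular momentum operator `Hₖ = -i d/dt R̂ₖ(t)` at `t = 0`. -/
def H (k : Fin 3) : L2S →ₗ.[ℂ] L2S := (-Complex.I) • rotGenerator k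

/-- The square `T²` of an unbounded operator, on its natural domain
`{ψ ∈ D(T) : T ψ ∈ D(T)}`. -/
def square {V : Type*} [AddCommGroup V] [Module ℂ V] (T : V →ₗ.[ℂ] V) : V →ₗ.[ℂ] V where
  domain :=
    { carrier := {ψ | ∃ h : ψ ∈ T.domain, T ⟨ψ, h⟩ ∈ T.domain}
      add_mem' := by
        rintro a b ⟨ha, ha'⟩ ⟨hb, hb'⟩
        refine ⟨T.domain.add_mem ha hb, ?_⟩
        have := T.map_add ⟨a, ha⟩ ⟨b, hb⟩
        rw [AddMemClass.mk_add_mk] at this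
        rw [this]
        exact T.domain.add_mem ha' hb'
      zero_mem' := ⟨T.domain.zero_mem, by
        have : T ⟨0, T.domain.zero_mem⟩ = 0 := T.map_zero
        rw [this]
        exact T.domain.zero_mem⟩
      smul_mem' := by
        rintro c a ⟨ha, ha'⟩
        refine ⟨T.domain.smul_mem c ha, ?_⟩
        have : T ⟨c • a, T.domain.smul_mem c ha⟩ = c • T ⟨a, ha⟩ := T.map_smul c ⟨a, ha⟩
        rw [this]
        exact T.domain.smul_mem c ha' }
  toFun :=
    { toFun := fun ψ => T ⟨T ⟨ψ, ψ.2.1⟩, ψ.2.2⟩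
      map_add' := fun a b => by
        rw [← T.map_add]
        congr 1
        exact Subtype.ext (T.map_add ⟨a, a.2.1⟩ ⟨b, b.2.1⟩)
      map_smul' := fun c a => by
        rw [RingHom.id_apply, ← T.map_smul]
        congr 1
        exact Subtype.ext (T.map_smul c ⟨a, a.2.1⟩) }

/-- `H² = H₁² + H₂² + H₃²`; the domain of the sum is the intersection of the three domains. -/
def Hsq : L2S →ₗ.[ℂ] L2S := square (H 0) + square (H 1) + square (H 2)

/-- The joint eigenspace of `H₃` (eigenvalue `a`) and `H²` (eigenvalue `b`). -/
def jointEigenspace (a b : ℂ) : Submodule ℂ L2S where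
  carrier := {ψ | (∃ h : ψ ∈ (H 2).domain, H 2 ⟨ψ, h⟩ = a • ψ) ∧
    ∃ h : ψ ∈ Hsq.domain, Hsq ⟨ψ, h⟩ = b • ψ}
  add_mem' := by
    rintro x y ⟨⟨hx, hx'⟩, kx, kx'⟩ ⟨⟨hy, hy'⟩, ky, ky'⟩
    refine ⟨⟨add_mem hx hy, ?_⟩, add_mem kx ky, ?_⟩
    · rw [smul_add, ← hx', ← hy']
      exact (H 2).map_add ⟨x, hx⟩ ⟨y, hy⟩
    · rw [smul_add, ← kx', ← ky']
      exact Hsq.map_add ⟨x, kx⟩ ⟨y, ky⟩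
  zero_mem' := by
    refine ⟨⟨zero_mem _, ?_⟩, zero_mem _, ?_⟩
    · rw [smul_zero]
      exact (H 2).map_zero
    · rw [smul_zero]
      exact Hsq.map_zero
  smul_mem' := by
    rintro c x ⟨⟨hx, hx'⟩, kx, kx'⟩
    refine ⟨⟨Submodule.smul_mem _ c hx, ?_⟩, Submodule.smul_mem _ c kx, ?_⟩
    · rw [smul_comm, ← hx']
      exact (H 2).map_smul c ⟨x, hx⟩
    · rw [smul_comm, ← kx']
      exact Hsq.map_smul c ⟨x, kx⟩

/-- The point of the sphere with polar angle `θ` and azimuth `φ`. -/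
def sphPoint (θ φ : ℝ) : S2 :=
  ⟨!₂[Real.sin θ * Real.cos φ, Real.sin θ * Real.sin φ, Real.cos θ], by
    rw [mem_sphere_zero_iff_norm, EuclideanSpace.norm_eq, Real.sqrt_eq_one]
    simp only [Fin.sum_univ_three, Real.norm_eq_abs, sq_abs]
    simp
    linear_combination (Real.sin θ ^ 2) * Real.sin_sq_add_cos_sq φ + Real.sin_sq_add_cos_sq θ⟩

/-- The pairs `(l, m)` with `l = 0, 1, 2, …` and `m = -l, -l + 1, …, l`. -/
abbrev Index : Type := Σ l : ℕ, {m : ℤ // -(l : ℤ) ≤ m ∧ m ≤ (l : ℤ)}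

end SphericalHarmonics

end

/-!
The rotations act unitarily, so `H₃` and `H²` are symmetric and joint eigenvectors belonging to
different pairs of eigenvalues are orthogonal. On the restriction to the sphere of a polynomial the
operators `Hₖ` act through derivations of the polynomial ring. The form `x₁ ± i x₂` is isotropic, so
the Leibniz rule for second order operators turns `H²` on `(x₁ ± i x₂)ⁿ q(x₃)` into the associated
Legendre operator acting on `q`, and the `(l + n)`-th derivative of `(X² - 1)ˡ` is an eigenfunction
of the latter with eigenvalue `l (l + 1)`. For fixed `n` these derivatives span all polynomials, and
on the sphere every polynomial is a combination of the `(x₁ ± i x₂)ⁿ q(x₃)`, because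
`(x₁ + i x₂) (x₁ - i x₂) = 1 - x₃²` there. By the Stone–Weierstrass theorem the joint eigenfunctions
so obtained are therefore complete. A complete orthogonal family of joint eigenvectors with pairwise
distinct pairs of eigenvalues leaves room for no further joint eigenvector.
-/

noncomputable section

namespace SphericalHarmonics

section FormalAdjoint

variable {𝕜 E F : Type*} [RCLike 𝕜] [NormedAddCommGroup E] [InnerProductSpace 𝕜 E]
  [NormedAddCommGroup F] [InnerProductSpace 𝕜 F]

theorem isFormalAdjoint_add {S T : E →ₗ.[𝕜] F} {S' T' : F →ₗ.[𝕜] E} (hS : S.IsFormalAdjoint S')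
    (hT : T.IsFormalAdjoint T') : (S + T).IsFormalAdjoint (S' + T') := fun x y => by
  rw [LinearPMap.add_apply, LinearPMap.add_apply, inner_add_left, inner_add_right]
  exact congrArg₂ (· + ·) (hS ⟨x, x.2.1⟩ ⟨y, y.2.1⟩) (hT ⟨x, x.2.2⟩ ⟨y, y.2.2⟩)

theorem isFormalAdjoint_square {V : Type*} [NormedAddCommGroup V] [InnerProductSpace ℂ V]
    {T T' : V →ₗ.[ℂ] V} (h : T.IsFormalAdjoint T') : (square T).IsFormalAdjoint (square T') :=
  fun x y => (h ⟨T ⟨x, x.2.1⟩, x.2.2⟩ ⟨y, y.2.1⟩).trans (h ⟨x, x.2.1⟩ ⟨T' ⟨y, y.2.1⟩, y.2.2⟩)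

theorem conj_eq_of_isFormalAdjoint_of_inner_ne_zero {T : E →ₗ.[𝕜] E} {T' : E →ₗ.[𝕜] E}
    (h : T.IsFormalAdjoint T') {x : T.domain} {y : T'.domain} {a b : 𝕜}
    (hx : T x = a • (x : E)) (hy : T' y = b • (y : E)) (hxy : inner 𝕜 (x : E) y ≠ 0) :
    starRingEnd 𝕜 a = b := by
  have hT := h x y
  rw [hx, hy, inner_smul_left, inner_smul_right] at hT
  exact mul_right_cancel₀ hxy hT

end FormalAdjoint

section HilbertBasis

theorem span_range_le_span_range_smul {ι K M : Type*} [DivisionRing K] [AddCommGroup M]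
    [Module K M] {c : ι → K} (hc : ∀ i, c i ≠ 0) (e : ι → M) :
    Submodule.span K (Set.range e) ≤ Submodule.span K (Set.range fun i => c i • e i) := by
  refine Submodule.span_le.2 (Set.range_subset_iff.2 fun i => ?_)
  rw [SetLike.mem_coe, ← Submodule.smul_mem_iff _ (hc i)]
  exact Submodule.subset_span ⟨i, rfl⟩

variable {ι 𝕜 E : Type*} [RCLike 𝕜] [NormedAddCommGroup E] [InnerProductSpace 𝕜 E]
  (b : HilbertBasis ι 𝕜 E)

theorem exists_hilbertBasis_inner_ne_zero {x : E} (hx : x ≠ 0) : ∃ i, inner 𝕜 (b i) x ≠ 0 := by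
  contrapose! hx
  refine (b.hasSum_repr x).unique ?_
  simpa only [b.repr_apply_apply, hx, zero_smul] using hasSum_zero

theorem eq_span_singleton_of_hilbertBasis {V : Submodule 𝕜 E} {i : ι} (hi : b i ∈ V)
    (hV : ∀ x ∈ V, ∀ j ≠ i, inner 𝕜 (b j) x = 0) : V = Submodule.span 𝕜 {b i} := by
  refine le_antisymm (fun x hx => Submodule.mem_span_singleton.2 ⟨b.repr x i, ?_⟩)
    ((Submodule.span_singleton_le_iff_mem _ _).2 hi)
  refine (hasSum_single i fun j hj => ?_).unique (b.hasSum_repr x)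
  rw [b.repr_apply_apply, hV x hx j hj, zero_smul]

theorem orthonormal_inv_norm_smul {e : ι → E} (hne : ∀ i, e i ≠ 0)
    (horth : Pairwise fun i j => inner 𝕜 (e i) (e j) = 0) :
    Orthonormal 𝕜 fun i => ((‖e i‖⁻¹ : ℝ) : 𝕜) • e i := by
  refine ⟨fun i => ?_, fun i j hij => ?_⟩
  · rw [norm_smul, RCLike.norm_ofReal, abs_inv, abs_norm,
      inv_mul_cancel₀ (norm_ne_zero_iff.2 (hne i))]
  · change inner 𝕜 (_ • e i) (_ • e j) = 0
    rw [inner_smul_left, inner_smul_right, horth hij, mul_zero, mul_zero]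

/-- The Hilbert basis obtained by normalizing an orthogonal family `e` of nonzero vectors with
dense span. -/
def hilbertBasisOfOrthogonal [CompleteSpace E] (e : ι → E) (hne : ∀ i, e i ≠ 0)
    (horth : Pairwise fun i j => inner 𝕜 (e i) (e j) = 0)
    (hdense : Dense (Submodule.span 𝕜 (Set.range e) : Set E)) : HilbertBasis ι 𝕜 E :=
  HilbertBasis.mk (orthonormal_inv_norm_smul hne horth)
    (Submodule.dense_iff_topologicalClosure_eq_top.1 (hdense.mono (span_range_le_span_range_smul
      (fun i => RCLike.ofReal_ne_zero.2 (inv_ne_zero (norm_ne_zero_iff.2 (hne i)))) e))).ge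

theorem hilbertBasisOfOrthogonal_apply [CompleteSpace E] (e : ι → E) (hne : ∀ i, e i ≠ 0)
    (horth : Pairwise fun i j => inner 𝕜 (e i) (e j) = 0)
    (hdense : Dense (Submodule.span 𝕜 (Set.range e) : Set E)) (i : ι) :
    hilbertBasisOfOrthogonal e hne horth hdense i = ((‖e i‖⁻¹ : ℝ) : 𝕜) • e i := by
  rw [hilbertBasisOfOrthogonal, HilbertBasis.coe_mk]

end HilbertBasis

/-! ### Symmetry of the angular momentum operators -/

theorem sphereRotation_zero (k : Fin 3) : sphereRotation k 0 = id := by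
  funext x
  refine Subtype.ext (PiLp.ext fun j => ?_)
  change (if j = k then (x : E3) k
    else if j = k + 1 then Real.cos 0 * (x : E3) (k + 1) - Real.sin 0 * (x : E3) (k + 2)
    else Real.sin 0 * (x : E3) (k + 1) + Real.cos 0 * (x : E3) (k + 2)) = (x : E3) j
  fin_cases k <;> fin_cases j <;> simp

theorem rotHat_zero (k : Fin 3) (ψ : L2S) : rotHat k 0 ψ = ψ := by
  have compMeasurePreserving_eq_self (f : S2 → S2) (hf : MeasurePreserving f dS dS) (hid : f = id) :
      Lp.compMeasurePreserving f hf ψ = ψ := by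
    subst hid
    exact Lp.compMeasurePreserving_id_apply ψ
  exact compMeasurePreserving_eq_self _ _ (sphereRotation_zero k)

theorem inner_rotHat (k : Fin 3) (t : ℝ) (φ ψ : L2S) :
    inner ℂ (rotHat k t φ) (rotHat k t ψ) = inner ℂ φ ψ :=
  (Lp.compMeasurePreservingₗᵢ ℂ (sphereRotation k t)
    (measurePreserving_sphereRotation k t)).inner_map_map φ ψ

theorem exists_H_eq_of_hasDerivAt {k : Fin 3} {ψ χ : L2S}
    (h : HasDerivAt (fun t : ℝ => rotHat k t ψ) χ 0) :
    ∃ hψ : ψ ∈ (H k).domain, H k ⟨ψ, hψ⟩ = -Complex.I • χ :=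
  ⟨h.differentiableAt, congrArg (-Complex.I • ·) h.deriv⟩

theorem hasDerivAt_rotHat {k : Fin 3} (ψ : (H k).domain) :
    HasDerivAt (fun t : ℝ => rotHat k t ψ) (Complex.I • H k ψ) 0 := by
  have hH : H k ψ = -Complex.I • deriv (fun t : ℝ => rotHat k t ψ) 0 := rfl
  rw [hH, smul_smul, mul_neg, Complex.I_mul_I, neg_neg, one_smul]
  exact DifferentiableAt.hasDerivAt ψ.2

theorem isFormalAdjoint_H (k : Fin 3) : (H k).IsFormalAdjoint (H k) := fun φ ψ => by
  -- `⟪R̂ₖ(t) φ, R̂ₖ(t) ψ⟫` does not depend on `t`, so its derivative at `0` vanishes.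
  have hderiv := (hasDerivAt_rotHat φ).inner ℂ (hasDerivAt_rotHat ψ)
  simp only [inner_rotHat, rotHat_zero, inner_smul_left, inner_smul_right, Complex.conj_I] at hderiv
  have hzero := hderiv.unique (hasDerivAt_const _ _)
  exact mul_left_cancel₀ Complex.I_ne_zero (by linear_combination -hzero)

theorem isFormalAdjoint_Hsq : Hsq.IsFormalAdjoint Hsq :=
  have hsquare (k : Fin 3) := isFormalAdjoint_square (isFormalAdjoint_H k)
  isFormalAdjoint_add (isFormalAdjoint_add (hsquare 0) (hsquare 1)) (hsquare 2)

theorem conj_eq_and_conj_eq_of_inner_ne_zero {a b a' b' : ℂ} {φ ψ : L2S}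
    (hφ : φ ∈ jointEigenspace a b) (hψ : ψ ∈ jointEigenspace a' b') (h : inner ℂ φ ψ ≠ 0) :
    starRingEnd ℂ a = a' ∧ starRingEnd ℂ b = b' := by
  obtain ⟨⟨_, hHφ⟩, _, hHsqφ⟩ := hφ
  obtain ⟨⟨_, hHψ⟩, _, hHsqψ⟩ := hψ
  exact ⟨conj_eq_of_isFormalAdjoint_of_inner_ne_zero (isFormalAdjoint_H 2) hHφ hHψ h,
    conj_eq_of_isFormalAdjoint_of_inner_ne_zero isFormalAdjoint_Hsq hHsqφ hHsqψ h⟩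

/-! ### Sums of squares of derivations -/

section Euler

open Polynomial

theorem mul_aeval_derivative_X_pow {R A : Type*} [CommSemiring R] [CommSemiring A] [Algebra R A]
    (f : A) (n : ℕ) : f * aeval f (derivative (X ^ n : R[X])) = n * f ^ n := by
  rcases n with _ | n
  · simp
  · simp only [derivative_X_pow, Nat.add_sub_cancel, map_mul, map_pow, map_natCast, aeval_X]
    ring

theorem sq_mul_aeval_derivative_derivative_X_pow {R A : Type*} [CommSemiring R] [CommRing A]
    [Algebra R A] (f : A) (n : ℕ) :
    f ^ 2 * aeval f (derivative (derivative (X ^ n : R[X]))) = n * (n - 1) * f ^ n := by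
  rcases n with _ | n
  · simp
  · have hn := mul_aeval_derivative_X_pow (R := R) f n
    rw [derivative_X_pow, Nat.add_sub_cancel, C_eq_natCast, derivative_natCast_mul, map_mul,
      map_natCast]
    push_cast
    linear_combination (n + 1) * f * hn

end Euler

section SumOfSquares

open Polynomial

variable {ι R A : Type*} [Fintype ι] [CommSemiring R] [CommSemiring A] [Algebra R A]
  (D : ι → Derivation R A A)

/-- The second order operator `∑ᵢ Dᵢ²` attached to a finite family of derivations. -/
def sumSq : A →ₗ[R] A := ∑ i, (D i).toLinearMap ∘ₗ (D i).toLinearMap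

/-- The carré du champ `Γ(f, g) = ∑ᵢ Dᵢ f · Dᵢ g` of the operator `∑ᵢ Dᵢ²`: it measures the failure
of the Leibniz rule for this operator. -/
def carreDuChamp (f g : A) : A := ∑ i, D i f * D i g

theorem sumSq_apply (f : A) : sumSq D f = ∑ i, D i (D i f) := by
  simp [sumSq]

theorem sumSq_mul (f g : A) :
    sumSq D (f * g) = sumSq D f * g + 2 * carreDuChamp D f g + f * sumSq D g := by
  simp only [sumSq_apply, carreDuChamp, Finset.sum_mul, Finset.mul_sum, ← Finset.sum_add_distrib,
    Derivation.leibniz, smul_eq_mul, map_add]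
  exact Finset.sum_congr rfl fun i _ => by ring

theorem sumSq_aeval (f : A) (p : R[X]) :
    sumSq D (aeval f p) =
      aeval f (derivative (derivative p)) * carreDuChamp D f f +
        aeval f (derivative p) * sumSq D f := by
  simp only [sumSq_apply, carreDuChamp, Finset.mul_sum, ← Finset.sum_add_distrib,
    Derivation.map_aeval, Derivation.leibniz, smul_eq_mul]
  exact Finset.sum_congr rfl fun i _ => by ring

theorem carreDuChamp_aeval_aeval (f g : A) (p q : R[X]) :
    carreDuChamp D (aeval f p) (aeval g q) =
      aeval f (derivative p) * aeval g (derivative q) * carreDuChamp D f g := by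
  simp only [carreDuChamp, Finset.mul_sum, Derivation.map_aeval, smul_eq_mul]
  exact Finset.sum_congr rfl fun i _ => by ring

end SumOfSquares

section Derivation

variable {𝕜 R A σ : Type*} [NontriviallyNormedField 𝕜] [CommSemiring R] [NormedCommRing A]
  [NormedAlgebra 𝕜 A] [Algebra R A]

theorem hasDerivAt_of_forall_hasDerivAt_X {Φ : 𝕜 → MvPolynomial σ R →ₐ[R] A} {t₀ : 𝕜}
    (D : Derivation R (MvPolynomial σ R) (MvPolynomial σ R))
    (hX : ∀ j, HasDerivAt (fun t => Φ t (.X j)) (Φ t₀ (D (.X j))) t₀) (p : MvPolynomial σ R) :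
    HasDerivAt (fun t => Φ t p) (Φ t₀ (D p)) t₀ := by
  induction p using MvPolynomial.induction_on with
  | C a =>
    simpa only [← MvPolynomial.algebraMap_eq, AlgHom.commutes, Derivation.map_algebraMap, map_zero]
      using hasDerivAt_const t₀ _
  | add p q hp hq => simpa only [map_add] using! hp.add hq
  | mul_X p j hp =>
    convert! hp.mul (hX j) using 1
    · exact funext fun t => map_mul _ _ _
    · simp only [Derivation.leibniz, smul_eq_mul, map_add, map_mul]
      ring

end Derivation

/-! ### Polynomials on the sphere -/

section Rotations

open MvPolynomial

/-- The coordinate functions on the sphere. -/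
def coord (j : Fin 3) : C(S2, ℂ) := ⟨fun x => ((x : E3) j : ℂ), by fun_prop⟩

/-- The restriction of complex polynomials in three variables to the sphere. -/
def onSphere : MvPolynomial (Fin 3) ℂ →ₐ[ℂ] C(S2, ℂ) := aeval coord

/-- The restriction of complex polynomials to the sphere, with values in `L²(S²)`. -/
def polyLp : MvPolynomial (Fin 3) ℂ →ₗ[ℂ] L2S :=
  (ContinuousMap.toLp 2 dS ℂ).toLinearMap ∘ₗ onSphere.toLinearMap

theorem polyLp_congr {p q : MvPolynomial (Fin 3) ℂ} (h : onSphere p = onSphere q) :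
    polyLp p = polyLp q :=
  congrArg (ContinuousMap.toLp 2 dS ℂ) h

/-- Composition of continuous functions with the rotation `Rₖ(t)`. -/
def rotPullback (k : Fin 3) (t : ℝ) : C(S2, ℂ) →ₐ[ℂ] C(S2, ℂ) :=
  ContinuousMap.compRightAlgHom ℂ ℂ ⟨sphereRotation k t, continuous_sphereRotation k t⟩

/-- The vector field generating the rotations around the axis `k`, as a derivation of the
polynomial ring. -/
def rotDerivation (k : Fin 3) : Derivation ℂ (MvPolynomial (Fin 3) ℂ) (MvPolynomial (Fin 3) ℂ) :=
  mkDerivation ℂ fun j => if j = k then 0 else if j = k + 1 then -X (k + 2) else X (k + 1)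

theorem rotPullback_zero (k : Fin 3) (f : C(S2, ℂ)) : rotPullback k 0 f = f := by
  ext x
  change f (sphereRotation k 0 x) = f x
  rw [sphereRotation_zero, id]

theorem rotPullback_coord (k j : Fin 3) (t : ℝ) : rotPullback k t (coord j) =
    if j = k then coord k
    else if j = k + 1 then Real.cos t • coord (k + 1) - Real.sin t • coord (k + 2)
    else Real.sin t • coord (k + 1) + Real.cos t • coord (k + 2) := by
  ext x
  change (((if j = k then (x : E3) k
    else if j = k + 1 then Real.cos t * (x : E3) (k + 1) - Real.sin t * (x : E3) (k + 2)
    else Real.sin t * (x : E3) (k + 1) + Real.cos t * (x : E3) (k + 2) : ℝ)) : ℂ) = _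
  split_ifs <;> simp [coord]

theorem hasDerivAt_rotPullback_coord (k j : Fin 3) :
    HasDerivAt (fun t : ℝ => rotPullback k t (coord j)) (onSphere (rotDerivation k (X j))) 0 := by
  simp only [rotPullback_coord, rotDerivation, mkDerivation_X]
  have hcos := Real.hasDerivAt_cos 0
  have hsin := Real.hasDerivAt_sin 0
  split_ifs
  · simpa only [map_zero] using hasDerivAt_const _ _
  · convert! (hcos.smul_const (coord (k + 1))).sub (hsin.smul_const (coord (k + 2))) using 1
    ext x
    simp [onSphere]
  · convert! (hsin.smul_const (coord (k + 1))).add (hcos.smul_const (coord (k + 2))) using 1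
    ext x
    simp [onSphere]

theorem hasDerivAt_rotPullback_onSphere (k : Fin 3) (p : MvPolynomial (Fin 3) ℂ) :
    HasDerivAt (fun t : ℝ => rotPullback k t (onSphere p)) (onSphere (rotDerivation k p)) 0 := by
  have h := hasDerivAt_of_forall_hasDerivAt_X (Φ := fun t : ℝ => (rotPullback k t).comp onSphere)
    (t₀ := 0) (rotDerivation k)
  simp only [AlgHom.comp_apply, rotPullback_zero] at h
  refine h (fun j => ?_) p
  simpa only [onSphere, aeval_X] using hasDerivAt_rotPullback_coord k j

theorem hasDerivAt_rotHat_polyLp (k : Fin 3) (p : MvPolynomial (Fin 3) ℂ) :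
    HasDerivAt (fun t : ℝ => rotHat k t (polyLp p)) (polyLp (rotDerivation k p)) 0 :=
  ((ContinuousMap.toLp 2 dS ℂ : C(S2, ℂ) →L[ℂ] L2S).restrictScalars ℝ).hasFDerivAt.comp_hasDerivAt
    (0 : ℝ) (hasDerivAt_rotPullback_onSphere k p)

theorem exists_H_polyLp_eq (k : Fin 3) (p : MvPolynomial (Fin 3) ℂ) :
    ∃ h : polyLp p ∈ (H k).domain,
      H k ⟨polyLp p, h⟩ = polyLp (-Complex.I • rotDerivation k p) := by
  rw [map_smul]
  exact exists_H_eq_of_hasDerivAt (hasDerivAt_rotHat_polyLp k p)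

theorem exists_square_H_polyLp_eq (k : Fin 3) (p : MvPolynomial (Fin 3) ℂ) :
    ∃ h : polyLp p ∈ (square (H k)).domain,
      square (H k) ⟨polyLp p, h⟩ = polyLp (-rotDerivation k (rotDerivation k p)) := by
  obtain ⟨hp, hHp⟩ := exists_H_polyLp_eq k p
  obtain ⟨hp', hHp'⟩ := exists_H_polyLp_eq k (-Complex.I • rotDerivation k p)
  refine ⟨⟨hp, hHp ▸ hp'⟩, ?_⟩
  change H k ⟨H k ⟨_, hp⟩, _⟩ = _
  simp only [hHp]
  rw [hHp', Derivation.map_smul, smul_smul, neg_mul_neg, Complex.I_mul_I, neg_one_smul]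

theorem exists_Hsq_polyLp_eq (p : MvPolynomial (Fin 3) ℂ) :
    ∃ h : polyLp p ∈ Hsq.domain, Hsq ⟨polyLp p, h⟩ = polyLp (-sumSq rotDerivation p) := by
  obtain ⟨h₀, e₀⟩ := exists_square_H_polyLp_eq 0 p
  obtain ⟨h₁, e₁⟩ := exists_square_H_polyLp_eq 1 p
  obtain ⟨h₂, e₂⟩ := exists_square_H_polyLp_eq 2 p
  refine ⟨⟨⟨h₀, h₁⟩, h₂⟩, ?_⟩
  change square (H 0) ⟨_, h₀⟩ + square (H 1) ⟨_, h₁⟩ + square (H 2) ⟨_, h₂⟩ = _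
  rw [e₀, e₁, e₂, sumSq_apply, Fin.sum_univ_three, neg_add, neg_add, map_add, map_add]

end Rotations

/-! ### Joint eigenfunctions -/

section Rodrigues

open Polynomial

/-- The `n`-th derivative of `(X² - 1)ˡ`. By Rodrigues' formula it is, for `n = l + m` and up to a
constant factor, the `m`-th derivative of the Legendre polynomial of degree `l`. -/
def rodrigues (R : Type*) [CommRing R] (l n : ℕ) : R[X] :=
  derivative^[n] ((X ^ 2 - 1) ^ l)

variable {R : Type*} [CommRing R]

theorem derivative_rodrigues (l n : ℕ) :
    derivative (rodrigues R l n) = rodrigues R l (n + 1) :=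
  (Function.iterate_succ_apply' _ _ _).symm

theorem map_rodrigues {R' : Type*} [CommRing R'] (f : R →+* R') (l n : ℕ) :
    (rodrigues R l n).map f = rodrigues R' l n := by
  simp [rodrigues, ← iterate_derivative_map]

theorem X_sq_sub_one_mul_rodrigues_one (l : ℕ) :
    (X ^ 2 - 1) * rodrigues R l 1 = 2 * (l : R[X]) * X * rodrigues R l 0 := by
  rw [← derivative_rodrigues]
  simp only [rodrigues, Function.iterate_zero, id]
  rcases l with _ | l
  · simp
  · rw [derivative_pow]
    simp only [derivative_sub, derivative_X_pow, derivative_one, map_natCast, Nat.add_sub_cancel,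
      Nat.cast_ofNat, map_ofNat, pow_one, sub_zero, Nat.reduceSub]
    ring

theorem rodrigues_differential_equation (l n : ℕ) :
    (X ^ 2 - 1) * rodrigues R l (n + 2)
      + 2 * ((n : R[X]) + 1 - (l : R[X])) * X * rodrigues R l (n + 1)
      + ((n : R[X]) + 1) * ((n : R[X]) - 2 * (l : R[X])) * rodrigues R l n = 0 := by
  induction n with
  | zero =>
    have h := congrArg derivative (X_sq_sub_one_mul_rodrigues_one (R := R) l)
    simp only [derivative_sub, derivative_mul, derivative_rodrigues, derivative_X_pow,
      derivative_one, derivative_natCast, derivative_X, derivative_ofNat, map_ofNat,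
      Nat.cast_ofNat] at h
    push_cast
    linear_combination h
  | succ n ih =>
    have h := congrArg derivative ih
    simp only [derivative_sub, derivative_add, derivative_mul, derivative_rodrigues,
      derivative_X_pow, derivative_one, derivative_natCast, derivative_X, derivative_ofNat,
      derivative_zero, map_ofNat, Nat.cast_ofNat] at h
    push_cast
    linear_combination h

theorem associatedLegendre_equation_rodrigues (l n : ℕ) :
    (1 - X ^ 2) * derivative (derivative (rodrigues R l (l + n)))
      - 2 * ((n : R[X]) + 1) * X * derivative (rodrigues R l (l + n))
      - (n : R[X]) * ((n : R[X]) + 1) * rodrigues R l (l + n) =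
        -((l : R) * (l + 1)) • rodrigues R l (l + n) := by
  have h := rodrigues_differential_equation (R := R) l (l + n)
  simp only [derivative_rodrigues, smul_eq_C_mul, map_neg, map_mul, map_add, map_natCast, map_one]
  push_cast at h
  linear_combination -h

theorem degree_rodrigues [CharZero R] {l n d : ℕ} (h : n + d = 2 * l) :
    (rodrigues R l n).degree = d := by
  have hmonic₂ : (X ^ 2 - 1 : R[X]).Monic := monic_X_pow_sub_C (1 : R) two_ne_zero
  have hnatDegree₂ : (X ^ 2 - 1 : R[X]).natDegree = 2 :=
    natDegree_X_pow_sub_C (r := (1 : R))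
  have hnatDegree : ((X ^ 2 - 1 : R[X]) ^ l).natDegree = d + n := by
    rw [hmonic₂.natDegree_pow, hnatDegree₂]
    lia
  refine le_antisymm (degree_le_of_natDegree_le ?_) (le_degree_of_ne_zero ?_)
  · exact (natDegree_iterate_derivative _ n).trans (by lia)
  · rw [rodrigues, coeff_iterate_derivative, ← hnatDegree, (hmonic₂.pow l).coeff_natDegree,
      hnatDegree]
    simp [Nat.descFactorial_eq_zero_iff_lt]

end Rodrigues

section Tesseral

open MvPolynomial
open scoped Polynomial

/-- The linear form `x₁ + c x₂`. For `c = ± i` it is isotropic, that is, its gradient `(1, c, 0)`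
satisfies `1 + c² = 0`. -/
def planar (c : ℂ) : MvPolynomial (Fin 3) ℂ := X 0 + C c * X 1

/-- The polynomial `(x₁ + c x₂)ⁿ q(x₃)`, depending linearly on `q`. -/
def tesseral (c : ℂ) (n : ℕ) : ℂ[X] →ₗ[ℂ] MvPolynomial (Fin 3) ℂ :=
  LinearMap.mulLeft ℂ (planar c ^ n) ∘ₗ (Polynomial.aeval (X 2)).toLinearMap

theorem tesseral_apply (c : ℂ) (n : ℕ) (q : ℂ[X]) :
    tesseral c n q = planar c ^ n * Polynomial.aeval (X 2) q := rfl

theorem C_sq_of_sq_eq_neg_one {c : ℂ} (hc : c ^ 2 = -1) :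
    (C c : MvPolynomial (Fin 3) ℂ) ^ 2 = -1 := by
  rw [← map_pow, hc, map_neg, map_one]

theorem rotDerivation_X (k j : Fin 3) : rotDerivation k (X j) =
    if j = k then 0 else if j = k + 1 then -X (k + 2) else X (k + 1) :=
  mkDerivation_X _ _ _

theorem rotDerivation_zero_X_two : rotDerivation 0 (X 2) = X 1 := rotDerivation_X 0 2

theorem rotDerivation_one_X_two : rotDerivation 1 (X 2) = -X 0 := rotDerivation_X 1 2

theorem rotDerivation_two_X_two : rotDerivation 2 (X 2) = 0 := rotDerivation_X 2 2

theorem rotDerivation_zero_planar (c : ℂ) : rotDerivation 0 (planar c) = -(C c * X 2) := by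
  simp [rotDerivation_X, planar]

theorem rotDerivation_one_planar (c : ℂ) : rotDerivation 1 (planar c) = X 2 := by
  simp [rotDerivation_X, planar]

theorem rotDerivation_two_planar {c : ℂ} (hc : c ^ 2 = -1) :
    rotDerivation 2 (planar c) = C c * planar c := by
  have h : rotDerivation 2 (planar c) = -X 1 + C c * X 0 := by simp [rotDerivation_X, planar]
  rw [h, planar]
  linear_combination -X 1 * C_sq_of_sq_eq_neg_one hc

theorem rotDerivation_rotDerivation_X (k j : Fin 3) :
    rotDerivation k (rotDerivation k (X j)) = (if j = k then X j else 0) - X j := by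
  fin_cases k <;> fin_cases j <;> simp [rotDerivation_X]

theorem sumSq_rotDerivation_X (j : Fin 3) : sumSq rotDerivation (X j) = -2 * X j := by
  simp only [sumSq_apply, rotDerivation_rotDerivation_X, Finset.sum_sub_distrib, Finset.sum_ite_eq,
    Finset.mem_univ, if_true, Finset.sum_const, Finset.card_univ, Fintype.card_fin, nsmul_eq_mul]
  push_cast
  ring

theorem sumSq_rotDerivation_planar (c : ℂ) :
    sumSq rotDerivation (planar c) = -2 * planar c := by
  simp only [planar, C_mul', map_add, map_smul, sumSq_rotDerivation_X, mul_add, mul_smul_comm]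

theorem carreDuChamp_rotDerivation_X_two :
    carreDuChamp rotDerivation (X 2) (X 2) = X 0 ^ 2 + X 1 ^ 2 := by
  rw [carreDuChamp, Fin.sum_univ_three, rotDerivation_zero_X_two, rotDerivation_one_X_two,
    rotDerivation_two_X_two]
  ring

theorem carreDuChamp_rotDerivation_planar_planar {c : ℂ} (hc : c ^ 2 = -1) :
    carreDuChamp rotDerivation (planar c) (planar c) = -planar c ^ 2 := by
  rw [carreDuChamp, Fin.sum_univ_three, rotDerivation_zero_planar, rotDerivation_one_planar,
    rotDerivation_two_planar hc]
  linear_combination (X 2 ^ 2 + planar c ^ 2) * C_sq_of_sq_eq_neg_one hc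

theorem carreDuChamp_rotDerivation_planar_X_two (c : ℂ) :
    carreDuChamp rotDerivation (planar c) (X 2) = -(X 2 * planar c) := by
  rw [carreDuChamp, Fin.sum_univ_three, rotDerivation_zero_planar, rotDerivation_one_planar,
    rotDerivation_zero_X_two, rotDerivation_one_X_two, rotDerivation_two_X_two, planar]
  ring

theorem rotDerivation_two_tesseral {c : ℂ} (hc : c ^ 2 = -1) (n : ℕ) (q : ℂ[X]) :
    rotDerivation 2 (tesseral c n q) = (n * c) • tesseral c n q := by
  rw [tesseral_apply, Derivation.leibniz, Derivation.leibniz_pow, Derivation.map_aeval,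
    rotDerivation_two_X_two, rotDerivation_two_planar hc, ← C_mul', map_mul, map_natCast]
  rcases n with _ | n
  · simp
  · simp only [smul_eq_mul, nsmul_eq_mul, Nat.add_sub_cancel]
    ring

theorem sumSq_rotDerivation_planar_pow {c : ℂ} (hc : c ^ 2 = -1) (n : ℕ) :
    sumSq rotDerivation (planar c ^ n) =
      -((n : MvPolynomial (Fin 3) ℂ) * (n + 1)) * planar c ^ n := by
  have h := sumSq_aeval rotDerivation (planar c) (.X ^ n)
  rw [carreDuChamp_rotDerivation_planar_planar hc, sumSq_rotDerivation_planar, map_pow,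
    Polynomial.aeval_X] at h
  linear_combination h - sq_mul_aeval_derivative_derivative_X_pow (R := ℂ) (planar c) n -
    2 * mul_aeval_derivative_X_pow (R := ℂ) (planar c) n

theorem carreDuChamp_rotDerivation_planar_pow_aeval (c : ℂ) (n : ℕ) (q : ℂ[X]) :
    carreDuChamp rotDerivation (planar c ^ n) (Polynomial.aeval (X 2) q) =
      -((n : MvPolynomial (Fin 3) ℂ) * X 2) * planar c ^ n *
        Polynomial.aeval (X 2) q.derivative := by
  have h := carreDuChamp_aeval_aeval rotDerivation (planar c) (X 2) (.X ^ n) q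
  rw [carreDuChamp_rotDerivation_planar_X_two, map_pow, Polynomial.aeval_X] at h
  linear_combination h - X 2 * Polynomial.aeval (X 2) q.derivative *
    mul_aeval_derivative_X_pow (R := ℂ) (planar c) n

theorem sumSq_rotDerivation_tesseral {c : ℂ} (hc : c ^ 2 = -1) (n : ℕ) (q : ℂ[X]) :
    sumSq rotDerivation (tesseral c n q) =
      planar c ^ n * ((X 0 ^ 2 + X 1 ^ 2) * Polynomial.aeval (X 2) q.derivative.derivative) -
        tesseral c n (2 * ((n : ℂ[X]) + 1) * .X * q.derivative + n * ((n : ℂ[X]) + 1) * q) := by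
  rw [tesseral_apply, sumSq_mul, sumSq_rotDerivation_planar_pow hc,
    carreDuChamp_rotDerivation_planar_pow_aeval, sumSq_aeval, carreDuChamp_rotDerivation_X_two,
    sumSq_rotDerivation_X, tesseral_apply]
  simp only [map_add, map_mul, map_natCast, map_one, map_ofNat, Polynomial.aeval_X]
  ring

theorem onSphere_X (j : Fin 3) : onSphere (X j) = coord j := aeval_X _ _

theorem onSphere_sum_sq : onSphere (X 0 ^ 2 + X 1 ^ 2 + X 2 ^ 2) = 1 := by
  ext x
  have h : ‖(x : E3)‖ ^ 2 = 1 := by simp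
  rw [EuclideanSpace.norm_sq_eq, Fin.sum_univ_three] at h
  simp only [Real.norm_eq_abs, sq_abs] at h
  simp only [map_add, map_pow, onSphere_X, coord, ContinuousMap.add_apply, ContinuousMap.pow_apply,
    ContinuousMap.coe_mk, ContinuousMap.one_apply]
  exact_mod_cast h

theorem onSphere_sumSq_rotDerivation_tesseral {c : ℂ} (hc : c ^ 2 = -1) (n : ℕ) (q : ℂ[X]) :
    onSphere (sumSq rotDerivation (tesseral c n q)) =
      onSphere (tesseral c n ((1 - .X ^ 2) * q.derivative.derivative -
        2 * ((n : ℂ[X]) + 1) * .X * q.derivative - (n : ℂ[X]) * ((n : ℂ[X]) + 1) * q)) := by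
  have hsphere := onSphere_sum_sq
  rw [sumSq_rotDerivation_tesseral hc]
  simp only [tesseral_apply, map_sub, map_add, map_mul, map_pow, map_natCast, map_one, map_ofNat,
    Polynomial.aeval_X] at hsphere ⊢
  linear_combination onSphere (planar c) ^ n *
    onSphere (Polynomial.aeval (X 2) q.derivative.derivative) * hsphere

theorem polyLp_tesseral_rodrigues_mem_jointEigenspace {c : ℂ} (hc : c ^ 2 = -1) (l n : ℕ) :
    polyLp (tesseral c n (rodrigues ℂ l (l + n))) ∈
      jointEigenspace (-Complex.I * (n * c)) (l * (l + 1)) := by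
  obtain ⟨hH, hH_eq⟩ := exists_H_polyLp_eq 2 (tesseral c n (rodrigues ℂ l (l + n)))
  obtain ⟨hHsq, hHsq_eq⟩ := exists_Hsq_polyLp_eq (tesseral c n (rodrigues ℂ l (l + n)))
  refine ⟨⟨hH, ?_⟩, hHsq, ?_⟩
  · rw [hH_eq, rotDerivation_two_tesseral hc, smul_smul, map_smul]
  · rw [hHsq_eq, map_neg, polyLp_congr (onSphere_sumSq_rotDerivation_tesseral hc n _),
      associatedLegendre_equation_rodrigues, map_smul, map_smul, neg_smul, neg_neg]

end Tesseral

section SphericalCoordinates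

open Polynomial

theorem coord_two_sphPoint (θ φ : ℝ) : coord 2 (sphPoint θ φ) = (Real.cos θ : ℂ) := by
  simp [coord, sphPoint]

theorem onSphere_planar_sphPoint {c : ℂ} (hc : c ^ 2 = -1) (θ φ : ℝ) :
    onSphere (planar c) (sphPoint θ φ) = Real.sin θ * Complex.exp (c * φ) := by
  have hexp : Complex.exp (c * φ) = Complex.cos φ + c * Complex.sin φ := by
    rcases sq_eq_sq_iff_eq_or_eq_neg.1 (hc.trans Complex.I_sq.symm) with rfl | rfl
    · rw [mul_comm, Complex.exp_mul_I, mul_comm]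
    · rw [neg_mul, ← mul_neg, mul_comm, Complex.exp_mul_I, Complex.cos_neg, Complex.sin_neg]
      ring
  have hplanar : onSphere (planar c) (sphPoint θ φ) =
      Real.sin θ * Real.cos φ + c * (Real.sin θ * Real.sin φ) := by
    simp [planar, coord, sphPoint, onSphere]
  rw [hplanar, hexp, Complex.ofReal_cos φ, Complex.ofReal_sin φ]
  ring

theorem onSphere_tesseral_apply (c : ℂ) (n : ℕ) (q : ℂ[X]) (x : S2) :
    onSphere (tesseral c n q) x = onSphere (planar c) x ^ n * q.eval (coord 2 x) := by
  rw [tesseral_apply, map_mul, map_pow, ContinuousMap.mul_apply, ContinuousMap.pow_apply,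
    ← Polynomial.aeval_algHom_apply, onSphere_X, Polynomial.aeval_continuousMap_apply]

theorem onSphere_tesseral_sphPoint {c : ℂ} (hc : c ^ 2 = -1) (n : ℕ) (q : ℂ[X]) (θ φ : ℝ) :
    onSphere (tesseral c n q) (sphPoint θ φ) =
      (Real.sin θ : ℂ) ^ n * q.eval (Real.cos θ : ℂ) * Complex.exp (n * c * φ) := by
  rw [onSphere_tesseral_apply, coord_two_sphPoint, onSphere_planar_sphPoint hc, mul_pow,
    ← Complex.exp_nat_mul, mul_assoc (n : ℂ)]
  ring

theorem onSphere_tesseral_ne_zero {c : ℂ} (hc : c ^ 2 = -1) (n : ℕ) {q : ℂ[X]} (hq : q ≠ 0) :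
    onSphere (tesseral c n q) ≠ 0 := by
  intro h
  obtain ⟨x, hx, hxq⟩ : ∃ x ∈ Set.Ioo (-1 : ℝ) 1, q.eval (x : ℂ) ≠ 0 := by
    by_contra! hroot
    have hinfinite := (Set.Ioo_infinite (neg_one_lt_zero.trans (zero_lt_one (α := ℝ)))).image
      Complex.ofReal_injective.injOn
    exact hq (eq_zero_of_infinite_isRoot q (hinfinite.mono (Set.image_subset_iff.2 hroot)))
  have hsin : (√(1 - x ^ 2) : ℂ) ≠ 0 :=
    Complex.ofReal_ne_zero.2 (Real.sqrt_pos.2 (by nlinarith [hx.1, hx.2])).ne'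
  have happly := onSphere_tesseral_sphPoint hc n q (Real.arccos x) 0
  rw [h, Real.cos_arccos hx.1.le hx.2.le, Real.sin_arccos] at happly
  exact mul_ne_zero (mul_ne_zero (pow_ne_zero n hsin) hxq) (Complex.exp_ne_zero _) happly.symm

end SphericalCoordinates

theorem onSphere_apply (p : MvPolynomial (Fin 3) ℂ) (x : S2) :
    onSphere p x = MvPolynomial.aeval (fun j => ((x : E3) j : ℂ)) p :=
  MvPolynomial.comp_aeval_apply coord (ContinuousMap.evalAlgHom ℂ ℂ x) p

theorem contMDiff_onSphere (p : MvPolynomial (Fin 3) ℂ) :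
    ContMDiff (𝓡 2) 𝓘(ℝ, ℂ) ∞ (onSphere p) := by
  have : Fact (Module.finrank ℝ E3 = 2 + 1) := ⟨finrank_euclideanSpace_fin⟩
  have hanalytic : AnalyticOnNhd ℝ (fun x : E3 => p.aeval fun j => (x j : ℂ)) Set.univ :=
    .aeval_mvPolynomial (fun j =>
      (Complex.ofRealCLM.comp (EuclideanSpace.proj j : E3 →L[ℝ] ℝ)).analyticOnNhd _) p
  rw [funext (onSphere_apply p)]
  exact hanalytic.contDiff.contMDiff.comp contMDiff_coe_sphere

/-! ### Completeness -/

section Completeness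

open Polynomial

theorem denseRange_mvPolynomial_aeval {X σ 𝕜 : Type*} [RCLike 𝕜] [TopologicalSpace X]
    [CompactSpace X] {f : σ → C(X, 𝕜)} (hstar : ∀ i, star (f i) = f i)
    (hsep : ∀ x y, x ≠ y → ∃ i, f i x ≠ f i y) :
    DenseRange (MvPolynomial.aeval (R := 𝕜) f) := by
  have hrange : star (Set.range f) = Set.range f := by
    rw [← Set.image_star, ← Set.range_comp]
    exact congrArg Set.range (funext hstar)
  have hadjoin : (StarAlgebra.adjoin 𝕜 (Set.range f) : Set C(X, 𝕜)) =
      Set.range (MvPolynomial.aeval (R := 𝕜) f) := by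
    rw [← StarSubalgebra.coe_toSubalgebra, StarAlgebra.adjoin_toSubalgebra, hrange, Set.union_self,
      Algebra.adjoin_range_eq_range_aeval, AlgHom.coe_range]
  have htop := ContinuousMap.starSubalgebra_topologicalClosure_eq_top_of_separatesPoints
    (StarAlgebra.adjoin 𝕜 (Set.range f)) fun x y hxy => by
      obtain ⟨i, hi⟩ := hsep x y hxy
      exact ⟨f i, ⟨f i, StarAlgebra.subset_adjoin 𝕜 _ ⟨i, rfl⟩, rfl⟩, hi⟩
  rw [DenseRange, dense_iff_closure_eq, ← hadjoin, ← StarSubalgebra.topologicalClosure_coe, htop,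
    StarSubalgebra.coe_top]

theorem denseRange_onSphere : DenseRange onSphere := by
  refine denseRange_mvPolynomial_aeval (fun j => ?_) fun x y hxy => ?_
  · ext x
    simp [coord]
  · contrapose! hxy
    exact Subtype.ext (PiLp.ext fun j => Complex.ofReal_injective (hxy j))

theorem denseRange_polyLp : DenseRange polyLp :=
  (ContinuousMap.toLp_denseRange ℂ dS ℂ (by simp)).comp denseRange_onSphere
    (ContinuousMap.toLp 2 dS ℂ).continuous

/-- The restrictions to the sphere of the polynomials `(x₁ ± i x₂)ⁿ q(x₃)`, with their linear
combinations. -/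
def tesseralSpan : Submodule ℂ C(S2, ℂ) :=
  Submodule.span ℂ {f | ∃ c : ℂ, c ^ 2 = -1 ∧ ∃ n q, onSphere (tesseral c n q) = f}

theorem onSphere_tesseral_mem_tesseralSpan {c : ℂ} (hc : c ^ 2 = -1) (n : ℕ) (q : ℂ[X]) :
    onSphere (tesseral c n q) ∈ tesseralSpan :=
  Submodule.subset_span ⟨c, hc, n, q, rfl⟩

theorem onSphere_planar_mul_planar_neg {c : ℂ} (hc : c ^ 2 = -1) :
    onSphere (planar c * planar (-c)) = onSphere (Polynomial.aeval (.X 2) (1 - X ^ 2 : ℂ[X])) := by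
  have hsphere := onSphere_sum_sq
  have hC := congrArg onSphere (C_sq_of_sq_eq_neg_one hc)
  simp only [planar, map_mul, map_add, map_neg, map_sub, map_one, map_pow, Polynomial.aeval_X]
    at hsphere hC ⊢
  linear_combination hsphere - onSphere (.X 1) ^ 2 * hC

theorem mul_mem_tesseralSpan_of_forall {g : C(S2, ℂ)}
    (hg : ∀ c : ℂ, c ^ 2 = -1 → ∀ n q, onSphere (tesseral c n q) * g ∈ tesseralSpan)
    {f : C(S2, ℂ)} (hf : f ∈ tesseralSpan) : f * g ∈ tesseralSpan := by
  induction hf using Submodule.span_induction with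
  | mem f hf =>
    obtain ⟨c, hc, n, q, rfl⟩ := hf
    exact hg c hc n q
  | zero => simp only [zero_mul, zero_mem]
  | add f f' _ _ hf hf' => simpa only [add_mul] using add_mem hf hf'
  | smul a f _ hf => simpa only [smul_mul_assoc] using Submodule.smul_mem _ a hf

theorem mul_coord_two_mem_tesseralSpan {f : C(S2, ℂ)} (hf : f ∈ tesseralSpan) :
    f * onSphere (.X 2) ∈ tesseralSpan := by
  refine mul_mem_tesseralSpan_of_forall (fun c hc n q => ?_) hf
  convert! onSphere_tesseral_mem_tesseralSpan hc n (q * X) using 1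
  simp only [tesseral_apply, map_mul, Polynomial.aeval_X, mul_assoc]

theorem mul_planar_mem_tesseralSpan {d : ℂ} (hd : d ^ 2 = -1) {f : C(S2, ℂ)}
    (hf : f ∈ tesseralSpan) : f * onSphere (planar d) ∈ tesseralSpan := by
  refine mul_mem_tesseralSpan_of_forall (fun c hc n q => ?_) hf
  rcases sq_eq_sq_iff_eq_or_eq_neg.1 (hd.trans hc.symm) with rfl | rfl
  · convert! onSphere_tesseral_mem_tesseralSpan hc (n + 1) q using 1
    simp only [tesseral_apply, map_mul, pow_succ]
    ring
  · rcases n with _ | n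
    · convert! onSphere_tesseral_mem_tesseralSpan hd 1 q using 1
      simp only [tesseral_apply, map_mul, pow_zero, pow_one, map_one]
      ring
    · convert! onSphere_tesseral_mem_tesseralSpan hc n ((1 - X ^ 2) * q) using 1
      have hmul := onSphere_planar_mul_planar_neg hc
      simp only [tesseral_apply, map_mul, pow_succ] at hmul ⊢
      linear_combination onSphere (planar c ^ n) * onSphere (aeval (.X 2) q) * hmul

theorem planar_add_planar_neg (c : ℂ) : planar c + planar (-c) = (2 : ℂ) • .X 0 := by
  simp only [planar, map_neg, MvPolynomial.smul_eq_C_mul, map_ofNat]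
  ring

theorem planar_sub_planar_neg (c : ℂ) : planar c - planar (-c) = (2 * c) • .X 1 := by
  simp only [planar, map_neg, MvPolynomial.smul_eq_C_mul, map_mul, map_ofNat]
  ring

theorem mul_coord_mem_tesseralSpan (j : Fin 3) {f : C(S2, ℂ)} (hf : f ∈ tesseralSpan) :
    f * onSphere (.X j) ∈ tesseralSpan := by
  have hI := mul_planar_mem_tesseralSpan Complex.I_sq hf
  have hnegI := mul_planar_mem_tesseralSpan (d := -Complex.I) (by rw [neg_sq, Complex.I_sq]) hf
  match j with
  | 0 =>
    rw [← Submodule.smul_mem_iff _ (two_ne_zero (α := ℂ)), ← mul_smul_comm, ← map_smul,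
      ← planar_add_planar_neg Complex.I, map_add, mul_add]
    exact add_mem hI hnegI
  | 1 =>
    rw [← Submodule.smul_mem_iff _ (mul_ne_zero two_ne_zero Complex.I_ne_zero), ← mul_smul_comm,
      ← map_smul, ← planar_sub_planar_neg, map_sub, mul_sub]
    exact sub_mem hI hnegI
  | 2 => exact mul_coord_two_mem_tesseralSpan hf

theorem onSphere_mem_tesseralSpan (p : MvPolynomial (Fin 3) ℂ) : onSphere p ∈ tesseralSpan := by
  induction p using MvPolynomial.induction_on with
  | C a =>
    convert! onSphere_tesseral_mem_tesseralSpan Complex.I_sq 0 (C a) using 2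
    simp [tesseral_apply]
  | add p q hp hq => simpa only [map_add] using add_mem hp hq
  | mul_X p j hp => simpa only [map_mul] using mul_coord_mem_tesseralSpan j hp

/-- The polynomials `rodrigues ℂ (n + j) (2 n + j)`, which have degree `j`. -/
def rodriguesSequence (n : ℕ) : Polynomial.Sequence ℂ where
  elems' j := rodrigues ℂ (n + j) (n + j + n)
  degree_eq' j := degree_rodrigues (by lia)

theorem tesseral_mem_span_range_rodrigues (c : ℂ) (n : ℕ) (q : ℂ[X]) :
    tesseral c n q ∈ Submodule.span ℂ
      (Set.range fun j => tesseral c n (rodrigues ℂ (n + j) (n + j + n))) := by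
  have hq : q ∈ Submodule.span ℂ (Set.range (rodriguesSequence n)) := by
    rw [(rodriguesSequence n).span fun j => by simp]
    exact Submodule.mem_top
  have hmap := Submodule.mem_map_of_mem (f := tesseral c n) hq
  rwa [Submodule.map_span, ← Set.range_comp] at hmap

end Completeness

/-! ### The spherical harmonics -/

section Harmonics

/-- The coefficient `± i` of `x₂` in the polynomial `harmonicPoly l m`, its sign being that
of `m`. -/
def imagSign (m : ℤ) : ℂ := if 0 ≤ m then Complex.I else -Complex.I

theorem imagSign_sq (m : ℤ) : imagSign m ^ 2 = -1 := by
  rw [imagSign]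
  split_ifs
  · exact Complex.I_sq
  · rw [neg_sq, Complex.I_sq]

theorem natAbs_mul_imagSign (m : ℤ) : (m.natAbs : ℂ) * imagSign m = Complex.I * m := by
  rw [← Int.cast_natCast, Int.natCast_natAbs, imagSign]
  split_ifs with hm
  · rw [abs_of_nonneg hm, mul_comm]
  · rw [abs_of_neg (not_le.1 hm), Int.cast_neg, neg_mul_neg, mul_comm]

theorem exists_tesseral_imagSign_eq {c : ℂ} (hc : c ^ 2 = -1) (n : ℕ) :
    ∃ m : ℤ, m.natAbs = n ∧ tesseral (imagSign m) n = tesseral c n := by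
  rcases sq_eq_sq_iff_eq_or_eq_neg.1 (hc.trans Complex.I_sq.symm) with rfl | rfl
  · exact ⟨n, Int.natAbs_natCast n, by rw [imagSign, if_pos n.cast_nonneg]⟩
  · rcases n with _ | n
    · exact ⟨0, rfl, by simp only [tesseral, pow_zero]⟩
    · exact ⟨-(n + 1 : ℕ), by rw [Int.natAbs_neg, Int.natAbs_natCast],
        by rw [imagSign, if_neg (by lia)]⟩

/-- The polynomial whose restriction to the sphere is, up to normalization, the spherical
harmonic `Yₗᵐ`. -/
def harmonicPoly (l : ℕ) (m : ℤ) : MvPolynomial (Fin 3) ℂ :=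
  tesseral (imagSign m) m.natAbs (rodrigues ℂ l (l + m.natAbs))

theorem polyLp_harmonicPoly_mem_jointEigenspace (l : ℕ) (m : ℤ) :
    polyLp (harmonicPoly l m) ∈ jointEigenspace m (l * (l + 1)) := by
  have h := polyLp_tesseral_rodrigues_mem_jointEigenspace (imagSign_sq m) l m.natAbs
  rwa [natAbs_mul_imagSign, ← mul_assoc, neg_mul, Complex.I_mul_I, neg_neg, one_mul] at h

theorem polyLp_harmonicPoly_ne_zero {l : ℕ} {m : ℤ} (h : m.natAbs ≤ l) :
    polyLp (harmonicPoly l m) ≠ 0 := by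
  have hq : rodrigues ℂ l (l + m.natAbs) ≠ 0 := by
    rw [← Polynomial.degree_ne_bot, degree_rodrigues (d := l - m.natAbs) (by lia)]
    exact WithBot.natCast_ne_bot _
  exact (map_ne_zero_iff _ (ContinuousMap.toLp_injective (𝕜 := ℂ) dS)).2
    (onSphere_tesseral_ne_zero (imagSign_sq m) m.natAbs hq)

theorem index_eq {i j : Index} (hm : ((j.2 : ℤ) : ℂ) = ((i.2 : ℤ) : ℂ))
    (hl : (j.1 : ℂ) * ((j.1 : ℂ) + 1) = (i.1 : ℂ) * ((i.1 : ℂ) + 1)) : j = i := by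
  obtain ⟨l, m, hm₁⟩ := i
  obtain ⟨l', m', hm₂⟩ := j
  have hl' : l' * (l' + 1) = l * (l + 1) := by exact_mod_cast hl
  obtain rfl : l' = l := by nlinarith
  obtain rfl : m' = m := by exact_mod_cast hm
  rfl

theorem eq_and_eq_of_inner_ne_zero {l : ℕ} {m : ℤ} {a b : ℂ} {φ ψ : L2S}
    (hφ : φ ∈ jointEigenspace m (l * (l + 1))) (hψ : ψ ∈ jointEigenspace a b)
    (h : inner ℂ φ ψ ≠ 0) : a = m ∧ b = l * (l + 1) := by
  have hconj := conj_eq_and_conj_eq_of_inner_ne_zero hφ hψ h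
  simp only [map_mul, map_add, map_one, map_natCast, map_intCast] at hconj
  exact ⟨hconj.1.symm, hconj.2.symm⟩

theorem inner_eq_zero_of_index_ne {i j : Index} (hij : i ≠ j) {φ ψ : L2S}
    (hφ : φ ∈ jointEigenspace (i.2 : ℤ) (i.1 * (i.1 + 1)))
    (hψ : ψ ∈ jointEigenspace (j.2 : ℤ) (j.1 * (j.1 + 1))) : inner ℂ φ ψ = 0 := by
  by_contra h
  obtain ⟨hm, hl⟩ := eq_and_eq_of_inner_ne_zero hφ hψ h
  exact hij (index_eq hm hl).symm

theorem pairwise_inner_polyLp_harmonicPoly_eq_zero : Pairwise fun i j : Index =>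
    inner ℂ (polyLp (harmonicPoly i.1 i.2)) (polyLp (harmonicPoly j.1 j.2)) = 0 :=
  fun _ _ hij => inner_eq_zero_of_index_ne hij (polyLp_harmonicPoly_mem_jointEigenspace _ _)
    (polyLp_harmonicPoly_mem_jointEigenspace _ _)

theorem tesseral_mem_span_range_harmonicPoly {c : ℂ} (hc : c ^ 2 = -1) (n : ℕ)
    (q : Polynomial ℂ) :
    tesseral c n q ∈ Submodule.span ℂ (Set.range fun i : Index => harmonicPoly i.1 i.2) := by
  obtain ⟨m, rfl, hm⟩ := exists_tesseral_imagSign_eq hc n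
  rw [← hm]
  refine Submodule.span_mono (Set.range_subset_iff.2 fun j => ?_)
    (tesseral_mem_span_range_rodrigues _ _ q)
  exact ⟨⟨m.natAbs + j, m, by lia, by lia⟩, rfl⟩

theorem dense_span_range_polyLp_harmonicPoly :
    Dense (Submodule.span ℂ (Set.range fun i : Index => polyLp (harmonicPoly i.1 i.2)) :
      Set L2S) := by
  have htesseral : tesseralSpan.map (ContinuousMap.toLp 2 dS ℂ).toLinearMap ≤
      Submodule.span ℂ (Set.range fun i : Index => polyLp (harmonicPoly i.1 i.2)) := by
    rw [tesseralSpan, Submodule.map_span_le]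
    rintro _ ⟨c, hc, n, q, rfl⟩
    have hmem := tesseral_mem_span_range_harmonicPoly hc n q
    have hmap := Submodule.mem_map_of_mem (f := polyLp) hmem
    rwa [Submodule.map_span, ← Set.range_comp] at hmap
  refine denseRange_polyLp.mono (Set.range_subset_iff.2 fun p => htesseral ?_)
  exact Submodule.mem_map_of_mem (onSphere_mem_tesseralSpan p)

/-- The Hilbert basis of spherical harmonics. -/
def harmonicBasis : HilbertBasis Index ℂ L2S :=
  hilbertBasisOfOrthogonal (fun i : Index => polyLp (harmonicPoly i.1 i.2))
    (fun i => polyLp_harmonicPoly_ne_zero (by have := i.2.2; lia))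
    pairwise_inner_polyLp_harmonicPoly_eq_zero dense_span_range_polyLp_harmonicPoly

/-- The factor normalizing `harmonicPoly i.1 i.2` in `L²(S²)`. -/
def normFactor (i : Index) : ℝ := ‖polyLp (harmonicPoly i.1 i.2)‖⁻¹

/-- The normalized spherical harmonics `Yₗᵐ`. -/
def sphericalHarmonic (i : Index) : C(S2, ℂ) :=
  onSphere ((normFactor i : ℂ) • harmonicPoly i.1 i.2)

theorem harmonicBasis_apply (i : Index) :
    harmonicBasis i = (normFactor i : ℂ) • polyLp (harmonicPoly i.1 i.2) :=
  hilbertBasisOfOrthogonal_apply _ _ _ _ i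

theorem harmonicBasis_eq_toLp_sphericalHarmonic (i : Index) :
    harmonicBasis i = ContinuousMap.toLp 2 dS ℂ (sphericalHarmonic i) :=
  (harmonicBasis_apply i).trans (map_smul polyLp _ _).symm

theorem harmonicBasis_mem_jointEigenspace (i : Index) :
    harmonicBasis i ∈ jointEigenspace ((i.2 : ℤ) : ℂ) ((i.1 : ℂ) * ((i.1 : ℂ) + 1)) := by
  rw [harmonicBasis_apply]
  exact Submodule.smul_mem _ _ (polyLp_harmonicPoly_mem_jointEigenspace _ _)

/-- The factor `Fₗᵐ(θ)` of the spherical harmonic `Yₗᵐ`. -/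
def polarFactor (i : Index) (θ : ℝ) : ℝ :=
  normFactor i * (Real.sin θ ^ (i.2 : ℤ).natAbs *
    (rodrigues ℝ i.1 (i.1 + (i.2 : ℤ).natAbs)).eval (Real.cos θ))

theorem sphericalHarmonic_sphPoint (i : Index) (θ φ : ℝ) :
    sphericalHarmonic i (sphPoint θ φ) =
      (polarFactor i θ : ℂ) * Complex.exp (Complex.I * ((i.2 : ℤ) : ℂ) * (φ : ℂ)) := by
  have heval : (rodrigues ℂ i.1 (i.1 + (i.2 : ℤ).natAbs)).eval (Real.cos θ : ℂ) =
      ((rodrigues ℝ i.1 (i.1 + (i.2 : ℤ).natAbs)).eval (Real.cos θ) : ℝ) := by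
    rw [← map_rodrigues Complex.ofRealHom]
    exact Polynomial.eval_map_apply (f := Complex.ofRealHom) _
  rw [sphericalHarmonic, map_smul, ContinuousMap.smul_apply, harmonicPoly,
    onSphere_tesseral_sphPoint (imagSign_sq _), heval, natAbs_mul_imagSign, polarFactor,
    smul_eq_mul]
  push_cast
  ring

theorem jointEigenspace_eq_span_harmonicBasis (i : Index) :
    jointEigenspace ((i.2 : ℤ) : ℂ) ((i.1 : ℂ) * ((i.1 : ℂ) + 1)) =
      Submodule.span ℂ {harmonicBasis i} :=
  eq_span_singleton_of_hilbertBasis _ (harmonicBasis_mem_jointEigenspace i) fun _ hψ j hji =>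
    inner_eq_zero_of_index_ne hji (harmonicBasis_mem_jointEigenspace j) hψ

theorem exists_index_of_jointEigenspace_ne_bot {a b : ℂ} (h : jointEigenspace a b ≠ ⊥) :
    ∃ i : Index, a = ((i.2 : ℤ) : ℂ) ∧ b = (i.1 : ℂ) * ((i.1 : ℂ) + 1) := by
  obtain ⟨ψ, hψ, hne⟩ := Submodule.exists_mem_ne_zero_of_ne_bot h
  obtain ⟨i, hi⟩ := exists_hilbertBasis_inner_ne_zero harmonicBasis hne
  exact ⟨i, eq_and_eq_of_inner_ne_zero (harmonicBasis_mem_jointEigenspace i) hψ hi⟩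

end Harmonics

end SphericalHarmonics

end

open SphericalHarmonics in
theorem mainTheorem2 :
    ∃ (Y : Index → S2 → ℂ) (F : Index → ℝ → ℝ) (hY : ∀ i, MemLp (Y i) 2 dS)
      (B : HilbertBasis Index ℂ L2S),
      -- the functions `Y i` are smooth and form an orthonormal basis
      (∀ i, ContMDiff (𝓡 2) 𝓘(ℝ, ℂ) ∞ (Y i)) ∧
      (∀ i, B i = (hY i).toLp (Y i)) ∧
      -- they are common eigenfunctions: `H₃ Y = m Y` and `H² Y = l (l + 1) Y`
      (∀ i, ∃ h : B i ∈ (H 2).domain, H 2 ⟨B i, h⟩ = ((i.2 : ℤ) : ℂ) • B i) ∧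
      (∀ i, ∃ h : B i ∈ Hsq.domain, Hsq ⟨B i, h⟩ = ((i.1 : ℂ) * ((i.1 : ℂ) + 1)) • B i) ∧
      -- their form in spherical coordinates
      (∀ i, ∀ θ ∈ Set.Icc 0 Real.pi, ∀ φ : ℝ,
        Y i (sphPoint θ φ) =
          (F i θ : ℂ) * Complex.exp (Complex.I * ((i.2 : ℤ) : ℂ) * (φ : ℂ))) ∧
      -- every joint eigenspace is one-dimensional, and there are no further ones
      (∀ i : Index, Module.finrank ℂ
        (jointEigenspace ((i.2 : ℤ) : ℂ) ((i.1 : ℂ) * ((i.1 : ℂ) + 1))) = 1) ∧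
      (∀ a b : ℂ, jointEigenspace a b ≠ ⊥ →
        ∃ i : Index, a = ((i.2 : ℤ) : ℂ) ∧ b = (i.1 : ℂ) * ((i.1 : ℂ) + 1)) := by
  refine ⟨fun i => sphericalHarmonic i, polarFactor,
    fun i => (sphericalHarmonic i).memLp dS ℂ, harmonicBasis, fun i => contMDiff_onSphere _,
    harmonicBasis_eq_toLp_sphericalHarmonic, fun i => (harmonicBasis_mem_jointEigenspace i).1,
    fun i => (harmonicBasis_mem_jointEigenspace i).2,
    fun i θ _ φ => sphericalHarmonic_sphPoint i θ φ, fun i => ?_,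
    fun _ _ => exists_index_of_jointEigenspace_ne_bot⟩
  rw [jointEigenspace_eq_span_harmonicBasis]
  exact finrank_span_singleton (harmonicBasis.orthonormal.ne_zero i)
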